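/- Let $G$ be a group acting by isometries on a proper $CAT(0)$ space $M$, and let $\partial M$ be its boundary at infinity (asymptoty classes of geodesic rays $\gamma:[0,\infty)\to M$), with the cone topology and the induced $G$-action. For a ray $\gamma$ let $\beta_\gamma(x)=\lim_{t\to\infty}(t-d(x,\gamma(t)))$ be its Busemann function. The horoballs at $e\in\partial M$ are the sets $\{x\in M:\beta_\gamma(x)\ge t\}$, where $\gamma$ represents $e$ and $t\in\mathbb R$. Let $A$ be a finitely generated $\mathbb ZG$-module. Choose a finite set $X$, an epimorphism $\epsilon:F\twoheadrightarrow A$ from the free $\mathbb ZG$-module $F$ on $X$, and for each $x\in X$ a non-empty finite set $h(x)\subseteq M$. For $c\in F$ let $h(c)=\bigcup g\,h(x)$, the union over all elements $gx$ of the $\mathbb Z$-basis $GX$ that occur in $c$ with non-zero coefficient (so $h(0)=\emptyset$). Put $v_\gamma(c)=\min\beta_\gamma(h(c))\in\mathbb R\cup\{\infty\}$, with $v_\gamma(0)=\infty$. For an additive endomorphism $\varphi$ of $F$ and $e\in\partial M$ represented by $\gamma$ let $\mathrm{gsh}_e(\varphi)=\inf_{0\ne c\in F}\bigl(v_\gamma(\varphi(c))-v_\gamma(c)\bigr)$,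 which does not depend on the choice of $\gamma$. A $G$-volley on $F$ is a $G$-equivariant map $\Phi$ from $F$ to the set of finite subsets of $F$; a selection from $\Phi$ is an additive endomorphism $\varphi$ of $F$ with $\varphi(c)\in\Phi(c)$ for all $c\in F$; and $\varphi$ is $G$-finitary if it is a selection from some $G$-volley. Define - $\Sigma(M;A)$ as the set of those $e\in\partial M$ such that for every horoball $HB$ at $e$ and every $a\in A$ there is $c\in F$ with $\epsilon(c)=a$ and $h(c)\subseteq HB$; - ${}^\circ\Sigma(M;A)$ as the set of those $e\in\partial M$ for which there is a $G$-finitary additive endomorphism $\varphi$ of $F$ with $\epsilon\varphi=\epsilon$ and $\mathrm{gsh}_e(\varphi)>0$. Theorem. For every finitely generated $\mathbb ZG$-module $A$, and whatever choices of $X$, $\epsilon$, $h$ are used for each of the two sets (possibly different ones for the two sets), $${}^\circ\Sigma(M;A)=\{e\in\partial M\mid \mathrm{cl}(Ge)\subseteq\Sigma(M;A)\},$$ where $\mathrm{cl}(Ge)$ is the closure of the orbit $Ge$ in the cone topology. Consequently: - a closed $G$-invariant set $E\subseteq\partial M$ satisfies $E\subseteq\Sigma(M;A)$ if and only if $E\subseteq{}^\circ\Sigma(M;A)$;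 - in particular, $\Sigma(M;A)=\partial M$ if and only if ${}^\circ\Sigma(M;A)=\partial M$. Moreover, for every choice of $X$, $\epsilon$, $h$ and every closed $G$-invariant $E\subseteq\Sigma(M;A)$ there are a real number $\nu>0$ and a $G$-volley $\Phi$ on $F$ with $\epsilon(\Phi(c))=\{\epsilon(c)\}$ for all $c\in F$, such that for each $e\in E$ some selection $\varphi_e$ from $\Phi$ satisfies $\mathrm{gsh}_e(\varphi_e)\ge\nu$. -/

import Mathlib

open Filter Topology
open scoped NNReal

noncomputable section

namespace CAT0Limit

/-! ### CAT(0) spaces, geodesic rays and the boundary at infinity -/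

/-- A `CAT(0)` space: a geodesic metric space whose geodesic triangles are no fatter than Euclidean
ones.  In `exists_geodesic`, `γ` is a geodesic from `x` to `y`, parametrized proportionally to
arc length on `[0, 1]`.  In `comparison`, the point `m` divides a geodesic from `x` to `y` in the
ratio `t : 1 - t`, and the right-hand side is the squared distance between the corresponding
points of the Euclidean comparison triangle for `p, x, y`. -/
class CAT0Space (M : Type*) [MetricSpace M] : Prop where
  exists_geodesic : ∀ x y : M, ∃ γ : ℝ → M, γ 0 = x ∧ γ 1 = y ∧
    ∀ s ∈ Set.Icc (0 : ℝ) 1, ∀ t ∈ Set.Icc (0 : ℝ) 1, dist (γ s) (γ t) = |s - t| * dist x y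
  comparison : ∀ (p x y m : M) (t : ℝ), 0 ≤ t → t ≤ 1 →
    dist x m = t * dist x y → dist m y = (1 - t) * dist x y →
    dist p m ^ 2 ≤ (1 - t) * dist p x ^ 2 + t * dist p y ^ 2 - t * (1 - t) * dist x y ^ 2

/-- A geodesic ray `[0, ∞) → M`: an isometric embedding of the half-line. -/
structure GeodesicRay (M : Type*) [MetricSpace M] where
  toFun : ℝ≥0 → M
  isometry : Isometry toFun

namespace GeodesicRay

variable {M : Type*} [MetricSpace M]

instance : CoeFun (GeodesicRay M) (fun _ => ℝ≥0 → M) := ⟨toFun⟩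

/-- A geodesic ray as a continuous map. -/
def toContinuousMap (γ : GeodesicRay M) : C(ℝ≥0, M) := ⟨γ.toFun, γ.isometry.continuous⟩

/-- The topology of uniform convergence on compact sets. -/
instance : TopologicalSpace (GeodesicRay M) :=
  TopologicalSpace.induced toContinuousMap ContinuousMap.compactOpen

/-- Two rays are asymptotic if they stay within a bounded distance of one another. -/
instance asymptotic : Setoid (GeodesicRay M) where
  r γ γ' := ∃ C : ℝ, ∀ t : ℝ≥0, dist (γ t) (γ' t) ≤ C
  iseqv :=
    { refl := fun γ => ⟨0, fun t => by simp⟩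
      symm := fun ⟨C, hC⟩ => ⟨C, fun t => by rw [dist_comm]; exact hC t⟩
      trans := fun ⟨C, hC⟩ ⟨D, hD⟩ =>
        ⟨C + D, fun t => (dist_triangle _ _ _).trans (add_le_add (hC t) (hD t))⟩ }

/-- The Busemann function of a ray, `β_γ(x) = lim_{t → ∞} (t - d(x, γ(t)))`; it is zero at the
origin of the ray and tends to `+∞` along the ray.  As `t - d(x, γ(t))` is nondecreasing and
bounded in `t`, the limit is the supremum (see `tendsto_busemann`). -/
def busemann (γ : GeodesicRay M) (x : M) : ℝ := ⨆ t : ℝ≥0, ((t : ℝ) - dist x (γ t))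

theorem tendsto_busemann (γ : GeodesicRay M) (x : M) :
    Tendsto (fun t : ℝ≥0 => (t : ℝ) - dist x (γ t)) atTop (𝓝 (γ.busemann x)) := by
  apply tendsto_atTop_ciSup
  · intro s t hst
    have h1 : dist (γ s) (γ t) = t - s := by
      rw [γ.isometry.dist_eq, NNReal.dist_eq, abs_sub_comm, abs_of_nonneg]
      exact sub_nonneg.2 (NNReal.coe_le_coe.2 hst)
    have h2 := dist_triangle x (γ s) (γ t)
    change (s : ℝ) - dist x (γ s) ≤ t - dist x (γ t)
    linarith
  · refine ⟨dist x (γ 0), ?_⟩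
    rintro _ ⟨t, rfl⟩
    have h1 : dist (γ 0) (γ t) = t := by
      rw [γ.isometry.dist_eq, NNReal.dist_eq]
      simp
    have h2 := dist_triangle (γ 0) x (γ t)
    rw [dist_comm (γ 0) x] at h2
    change (t : ℝ) - dist x (γ t) ≤ _
    linarith

/-- The horoball `HB_{γ,t}`, centred at the endpoint of `γ`, with `γ t` on its frontier when
`t > 0`. -/
def horoball (γ : GeodesicRay M) (t : ℝ) : Set M := {x | t ≤ γ.busemann x}

variable {G : Type*} [Group G] [MulAction G M] [IsIsometricSMul G M]

instance : MulAction G (GeodesicRay M) where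
  smul g γ := ⟨fun t => g • γ t, (isometry_smul M g).comp γ.isometry⟩
  one_smul γ := by
    cases γ
    change GeodesicRay.mk _ _ = _
    congr 1
    funext t
    exact one_smul G _
  mul_smul g g' γ := by
    change GeodesicRay.mk _ _ = GeodesicRay.mk _ _
    congr 1
    funext t
    exact mul_smul g g' _

theorem smul_apply (g : G) (γ : GeodesicRay M) (t : ℝ≥0) : (g • γ) t = g • γ t := rfl

end GeodesicRay

/-- The boundary at infinity `∂M`: asymptoty classes of geodesic rays. -/
def Boundary (M : Type*) [MetricSpace M] : Type _ :=
  Quotient (GeodesicRay.asymptotic (M := M))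

namespace Boundary

variable {M : Type*} [MetricSpace M]

/-- The endpoint at infinity of a ray. -/
def mk (γ : GeodesicRay M) : Boundary M := Quotient.mk GeodesicRay.asymptotic γ

/-- The cone topology on `∂M`, as the quotient of the space of all geodesic rays with the topology
of uniform convergence on compact sets.  For a proper `CAT(0)` space the rays issuing from any
fixed base point represent each boundary point exactly once, and the endpoint map restricts to a
homeomorphism from the space of these rays onto `∂M`: indeed the map that sends a ray to the
asymptotic ray issuing from the base point is continuous. -/
instance coneTopology : TopologicalSpace (Boundary M) :=
  TopologicalSpace.coinduced mk inferInstance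

variable {G : Type*} [Group G] [MulAction G M] [IsIsometricSMul G M]

/-- The action on `∂M` induced by an isometric action on `M`. -/
instance : MulAction G (Boundary M) where
  smul g := Quotient.map (g • ·) (by
    rintro γ γ' ⟨C, hC⟩
    refine ⟨C, fun t => ?_⟩
    change dist (g • γ t) (g • γ' t) ≤ C
    rw [dist_smul]
    exact hC t)
  one_smul e := by
    induction e using Quotient.inductionOn with
    | h γ => exact congrArg mk (one_smul G γ)
  mul_smul g g' e := by
    induction e using Quotient.inductionOn with
    | h γ => exact congrArg mk (mul_smul g g' γ)

theorem smul_mk (g : G) (γ : GeodesicRay M) : g • mk γ = mk (g • γ) := rfl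

end Boundary

/-! ### `G`-modules, volleys and `G`-finitary homomorphisms

A `G`-module is a module over the group ring `ℤG`. -/

section Finitary

variable {G : Type*} [Group G]

/-- The action of a group element on a `G`-module. -/
def gact {A : Type*} [AddCommGroup A] [Module (MonoidAlgebra ℤ G) A] (g : G) (a : A) : A :=
  MonoidAlgebra.single g (1 : ℤ) • a

variable {A B : Type*} [AddCommGroup A] [Module (MonoidAlgebra ℤ G) A]
  [AddCommGroup B] [Module (MonoidAlgebra ℤ G) B]

variable (G) in
/-- A `G`-volley from `A` to `B`: a `G`-equivariant map from `A` to the finite subsets of `B`. -/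
structure IsVolley (Φ : A → Set B) : Prop where
  finite : ∀ a, (Φ a).Finite
  equivariant : ∀ (g : G) (a : A), Φ (gact g a) = gact g '' Φ a

/-- The additive homomorphism `φ` is a selection from `Φ`. -/
def IsSelection (φ : A →+ B) (Φ : A → Set B) : Prop := ∀ a, φ a ∈ Φ a

variable (G) in
/-- An additive homomorphism is `G`-finitary if it is a selection from some `G`-volley. -/
def IsFinitary (φ : A →+ B) : Prop := ∃ Φ : A → Set B, IsVolley G Φ ∧ IsSelection φ Φ

end Finitary

/-! ### Controlled free presentations and limit sets -/

/-- The free `ℤG`-module on the set `X`; its `ℤ`-basis is `Y = GX`, identified with `X × G`. -/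
abbrev FreeMod (G X : Type*) [Group G] : Type _ := X →₀ MonoidAlgebra ℤ G

/-- A controlled based free presentation over `M` of the `G`-module `A`: an epimorphism `ε` from the
free `G`-module on `X` onto `A`, together with a choice of non-empty finite subsets `h₀ x` of `M`
for `x ∈ X`, from which the control map is built. -/
structure ControlledPresentation (G A M X : Type*) [Group G] [AddCommGroup A]
    [Module (MonoidAlgebra ℤ G) A] where
  ε : FreeMod G X →ₗ[MonoidAlgebra ℤ G] A
  surjective : Function.Surjective ε
  h₀ : X → Finset M
  nonempty : ∀ x, (h₀ x).Nonempty

namespace ControlledPresentation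

variable {G A M X : Type*} [Group G] [AddCommGroup A] [Module (MonoidAlgebra ℤ G) A]
  [MulAction G M] (P : ControlledPresentation G A M X)

/-- The control map `h`: the union of the translates `g • h₀ x` over all basis elements `gx` in the
support of `c`. -/
def h (c : FreeMod G X) : Set M :=
  {p | ∃ (x : X) (g : G), (c x).coeff g ≠ 0 ∧ ∃ q ∈ P.h₀ x, p = g • q}

theorem finite_h (c : FreeMod G X) : (P.h c).Finite := by
  have : P.h c ⊆ ⋃ x ∈ c.support, ⋃ g ∈ (c x).coeff.support, (g • ·) '' (P.h₀ x : Set M) := by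
    rintro p ⟨x, g, hg, q, hq, rfl⟩
    simp only [Set.mem_iUnion]
    refine ⟨x, ?_, g, Finsupp.mem_support_iff.2 hg, q, hq, rfl⟩
    rw [Finsupp.mem_support_iff]
    intro h0
    simp [h0] at hg
  refine Set.Finite.subset ?_ this
  exact c.support.finite_toSet.biUnion fun x _ =>
    (c x).coeff.support.finite_toSet.biUnion fun g _ => (P.h₀ x).finite_toSet.image _

theorem nonempty_h {c : FreeMod G X} (hc : c ≠ 0) : (P.h c).Nonempty := by
  obtain ⟨x, hx⟩ := Finsupp.ne_iff.1 hc
  have : ∃ g, (c x).coeff g ≠ 0 := by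
    by_contra! h0
    apply hx
    ext g
    simpa using h0 g
  obtain ⟨g, hg⟩ := this
  obtain ⟨q, hq⟩ := P.nonempty x
  exact ⟨g • q, x, g, hg, q, hq, rfl⟩

variable [MetricSpace M]

/-- The valuation `v_γ = min β_γ h` on the free module, with value `∞` at `0`. -/
def val (γ : GeodesicRay M) (c : FreeMod G X) : EReal := ⨅ p ∈ P.h c, (γ.busemann p : EReal)

/-- The guaranteed shift of `φ` towards the endpoint of `γ`: the infimum of
`v_γ (φ c) - v_γ c` over all `c` for which `v_γ c` is finite, i.e. over all `c ≠ 0`.  (In a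
`CAT(0)` space it depends only on the endpoint of `γ`.) -/
def gsh (γ : GeodesicRay M) (φ : FreeMod G X →+ FreeMod G X) : EReal :=
  ⨅ (c : FreeMod G X) (_ : c ≠ 0), (P.val γ (φ c) - P.val γ c)

/-- The horospherical limit set `Σ(M; A)`: the set of all boundary points `e` such that `A` is
supported over every horoball at `e`. -/
def horosphericalLimitSet : Set (Boundary M) :=
  {e | ∀ γ : GeodesicRay M, Boundary.mk γ = e → ∀ (t : ℝ) (a : A),
    ∃ c : FreeMod G X, P.ε c = a ∧ P.h c ⊆ γ.horoball t}

/-- The `G`-finitary dynamical limit set `°Σ(M; A)`: the set of all boundary points `e` for which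
there is a `G`-finitary additive endomorphism of the free module that induces the identity of `A`
and pushes towards `e`. -/
def finitaryLimitSet : Set (Boundary M) :=
  {e | ∃ φ : FreeMod G X →+ FreeMod G X, IsFinitary G φ ∧ (∀ c, P.ε (φ c) = P.ε c) ∧
    ∀ γ : GeodesicRay M, Boundary.mk γ = e → 0 < P.gsh γ φ}

end ControlledPresentation

end CAT0Limit

end

open CAT0Limit

/-!
The geometric input is that the differences `β_γ(p) - β_γ(q)` of values of a Busemann function
depend only on the endpoint `e` of the ray `γ` and are continuous in `e` for the cone topology. Both
follow from the comparison inequality. The quadrilateral inequality, applied to `p`, `q` and two far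
points of asymptotic rays, shows that Busemann functions of asymptotic rays differ by a constant;
and `t - d(p, γ(t))` converges to `β_γ(p)` at a rate controlled by `d(p, γ(0))`, so that `β_γ(p)` is
continuous in `γ`. Moreover `∂M` is compact for proper `M`: the rays from a base point form a
compact space, and each ray is asymptotic to one of them.

If `φ` is a `G`-finitary endomorphism pushing towards `e` by `δ`, then its conjugates `g φ g⁻¹` are
selections from the same volley and push towards `g e` by `δ`. All their `n`-fold iterates take a
given element `c₀` into one finite set, hence only finitely many points of `M` matter. For `g e`
close enough to `e'` the shift by `n δ` towards `g e` is therefore, up to the error `1`, a shift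
towards `e'`. Thus `cl(Ge) ⊆ Σ` (`closure_orbit_subset_horosphericalLimitSet`).

Conversely, let `E ⊆ Σ` be closed and invariant. For each `e ∈ E` the generators have lifts in the
free module that lie deeper by `1` with respect to all boundary points near `e`, so finitely many
lifts suffice for all of `E`. These lifts define a volley, and for `e ∈ E` one sends the basis
element `gx` to the `g`-translate of the lift of `x` that suits `g⁻¹ e ∈ E`
(`exists_volley_of_subset_horosphericalLimitSet`). Finally `Σ` does not depend on the presentation,
because lifts between two free presentations move control sets by a bounded distance
(`horosphericalLimitSet_subset`).
-/

open Filter Topology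
open scoped NNReal

noncomputable section

namespace CAT0Limit

/-! ### Busemann functions in `CAT(0)` spaces -/

section Geometry

variable {M : Type*} [MetricSpace M]

namespace CAT0Space

variable [CAT0Space M]

theorem exists_point_between (x y : M) {t : ℝ} (h0 : 0 ≤ t) (h1 : t ≤ 1) :
    ∃ m, dist x m = t * dist x y ∧ dist m y = (1 - t) * dist x y := by
  obtain ⟨γ, rfl, rfl, hγ⟩ := CAT0Space.exists_geodesic x y
  refine ⟨γ t, ?_, ?_⟩
  · rw [hγ 0 ⟨le_rfl, zero_le_one⟩ t ⟨h0, h1⟩, zero_sub, abs_neg, abs_of_nonneg h0]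
  · rw [hγ t ⟨h0, h1⟩ 1 ⟨zero_le_one, le_rfl⟩, abs_sub_comm, abs_of_nonneg (sub_nonneg.2 h1)]

/-- The sum of the squares of the diagonals of a quadrilateral is at most the sum of the squares
of its four sides. -/
theorem sq_dist_diagonals_le (a b c d : M) :
    dist a c ^ 2 + dist b d ^ 2 ≤
      dist a b ^ 2 + dist b c ^ 2 + dist c d ^ 2 + dist d a ^ 2 := by
  obtain ⟨m, hm1, hm2⟩ := exists_point_between b d (t := 1 / 2) (by norm_num) (by norm_num)
  have h1 := CAT0Space.comparison a b d m (1 / 2) (by norm_num) (by norm_num) hm1 hm2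
  have h2 := CAT0Space.comparison c b d m (1 / 2) (by norm_num) (by norm_num) hm1 hm2
  have h3 := dist_triangle_right a c m
  rw [dist_comm c b] at h2
  rw [dist_comm a d] at h1
  have h4 : dist a c ^ 2 ≤ (dist a m + dist c m) ^ 2 := by gcongr
  nlinarith [sq_nonneg (dist a m - dist c m)]

/-- In a triangle `x, y, z`, the two points that divide the sides from `z` in the same ratio are
no farther apart than in the Euclidean plane. -/
theorem dist_le_of_common_ratio {x y z a b : M} {u : ℝ} (h0 : 0 ≤ u) (h1 : u ≤ 1)
    (ha : dist x a = u * dist x z) (ha' : dist a z = (1 - u) * dist x z)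
    (hb : dist y b = u * dist y z) (hb' : dist b z = (1 - u) * dist y z) :
    dist a b ≤ (1 - u) * dist x y := by
  have e1 := CAT0Space.comparison b x z a u h0 h1 ha ha'
  have e2 := CAT0Space.comparison x y z b u h0 h1 hb hb'
  rw [hb'] at e1
  rw [dist_comm b x, dist_comm b a] at e1
  have h2 : 0 ≤ 1 - u := sub_nonneg.2 h1
  have h3 : 0 ≤ (1 - u) * dist x y := mul_nonneg h2 dist_nonneg
  refine abs_le_of_sq_le_sq' ?_ h3 |>.2
  nlinarith [mul_le_mul_of_nonneg_left e2 h2]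

end CAT0Space

namespace GeodesicRay

theorem dist_eq (γ : GeodesicRay M) (s t : ℝ≥0) : dist (γ s) (γ t) = |(s : ℝ) - t| := by
  rw [γ.isometry.dist_eq, NNReal.dist_eq]

theorem dist_zero (γ : GeodesicRay M) (t : ℝ≥0) : dist (γ 0) (γ t) = t := by
  rw [dist_eq]; simp

theorem abs_sub_dist_le (γ : GeodesicRay M) (x : M) (t : ℝ≥0) :
    |(t : ℝ) - dist x (γ t)| ≤ dist x (γ 0) := by
  have h := abs_dist_sub_le (γ 0) x (γ t)
  rwa [dist_zero, dist_comm (γ 0) x] at h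

theorem bddAbove_range (γ : GeodesicRay M) (x : M) :
    BddAbove (Set.range fun t : ℝ≥0 => (t : ℝ) - dist x (γ t)) := by
  refine ⟨dist x (γ 0), ?_⟩
  rintro _ ⟨t, rfl⟩
  exact (abs_le.1 (γ.abs_sub_dist_le x t)).2

theorem sub_dist_le_busemann (γ : GeodesicRay M) (x : M) (t : ℝ≥0) :
    (t : ℝ) - dist x (γ t) ≤ γ.busemann x :=
  le_ciSup (γ.bddAbove_range x) t

theorem busemann_sub_le_dist (γ : GeodesicRay M) (x y : M) :
    γ.busemann x - γ.busemann y ≤ dist x y := by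
  rw [sub_le_iff_le_add]
  refine ciSup_le fun t => ?_
  have h1 := γ.sub_dist_le_busemann y t
  have h2 := dist_triangle_left y (γ t) x
  linarith

theorem busemann_smul {G : Type*} [Group G] [MulAction G M] [IsIsometricSMul G M]
    (g : G) (γ : GeodesicRay M) (x : M) : (g • γ).busemann (g • x) = γ.busemann x := by
  simp only [busemann, smul_apply, dist_smul]

theorem continuous_eval (t : ℝ≥0) : Continuous fun γ : GeodesicRay M => γ t :=
  (continuous_eval_const (F := C(ℝ≥0, M)) t).comp
    (continuous_induced_dom (f := toContinuousMap (M := M)))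

variable [CAT0Space M]

/-- The defining limit of the Busemann function is approached at a rate that depends only on the
distance of the point to the origin of the ray. -/
theorem busemann_le (γ : GeodesicRay M) (x : M) {t : ℝ≥0} (ht : 0 < t) :
    γ.busemann x ≤ t - dist x (γ t) + dist x (γ 0) ^ 2 / (2 * t) := by
  have ht' : (0 : ℝ) < t := ht
  set β := γ.busemann x
  set d := dist x (γ t)
  set r := dist x (γ 0)
  have key : d ^ 2 ≤ r ^ 2 + t ^ 2 - 2 * t * β := by
    -- Compare `γ t` with the side from `γ 0` to `γ T` of the triangle with apex `x`; let `T → ∞`.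
    have hlim : Tendsto (fun T : ℝ≥0 => (1 - (t : ℝ) / T) * r ^ 2 + t ^ 2
        - 2 * t * ((T : ℝ) - dist x (γ T)) + t / T * ((T : ℝ) - dist x (γ T)) ^ 2) atTop
        (𝓝 ((1 - 0) * r ^ 2 + t ^ 2 - 2 * t * β + 0 * β ^ 2)) := by
      have hz : Tendsto (fun T : ℝ≥0 => (t : ℝ) / T) atTop (𝓝 0) :=
        tendsto_const_nhds.div_atTop (NNReal.tendsto_coe_atTop.2 tendsto_id)
      have hb := γ.tendsto_busemann x
      exact ((((tendsto_const_nhds.sub hz).mul_const _).add_const _).sub (hb.const_mul _)).add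
        (hz.mul (hb.pow 2))
    have := ge_of_tendsto hlim (b := d ^ 2) (by
      filter_upwards [eventually_ge_atTop t, eventually_gt_atTop 0] with T hT hT0
      have hT' : (t : ℝ) ≤ T := hT
      have hT0' : (0 : ℝ) < T := hT0
      have hc := CAT0Space.comparison x (γ 0) (γ T) (γ t) (t / T) (by positivity)
        ((div_le_one hT0').2 hT')
        (by rw [dist_zero, dist_zero]; field_simp)
        (by rw [dist_zero, dist_eq, abs_sub_comm, abs_of_nonneg (sub_nonneg.2 hT')]; field_simp)
      rw [dist_zero] at hc
      refine hc.trans (le_of_eq ?_)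
      field_simp
      ring)
    linarith
  have hd : |(t : ℝ) - d| ≤ r := γ.abs_sub_dist_le x t
  have hle : (2 * t) * (β - (t - d)) ≤ r ^ 2 := by nlinarith [sq_nonneg ((t : ℝ) - d)]
  have : β - (t - d) ≤ r ^ 2 / (2 * t) := by
    rw [le_div_iff₀ (by positivity)]; linarith
  linarith

/-- Busemann functions of asymptotic rays differ by a constant. -/
theorem busemann_sub_busemann_le {γ γ' : GeodesicRay M} (h : γ ≈ γ') (x y : M) :
    γ.busemann x - γ.busemann y ≤ γ'.busemann x - γ'.busemann y := by
  obtain ⟨C, hC⟩ := h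
  -- Let `D, E, D', E'` be the values of `t - d` for the four distances `d` from `x, y` to `γ t` and
  -- from `x, y` to `γ' t`. The quadrilateral inequality for `y, x, γ t, γ' t` bounds
  -- `2 t ((D - E) - (D' - E'))` by a quantity that converges as `t → ∞`.
  have hb : ∀ (η : GeodesicRay M) (z : M), Tendsto (fun t : ℝ≥0 => (t : ℝ) - dist z (η t)) atTop
    (𝓝 (η.busemann z)) := fun η z => η.tendsto_busemann z
  have hz : Tendsto (fun T : ℝ≥0 => (1 : ℝ) / T) atTop (𝓝 0) :=
    tendsto_const_nhds.div_atTop (NNReal.tendsto_coe_atTop.2 tendsto_id)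
  have hlim := ((((hb γ' x).pow 2).sub ((hb γ' y).pow 2)).sub
    (((hb γ x).pow 2).sub ((hb γ y).pow 2))).neg.add_const (dist x y ^ 2 + C ^ 2)
  have hl2 := (hlim.mul hz).div_const 2
  rw [mul_zero, zero_div] at hl2
  have hl3 := (((hb γ x).sub (hb γ y)).sub ((hb γ' x).sub (hb γ' y)))
  have := le_of_tendsto_of_tendsto hl3 hl2 (by
    filter_upwards [eventually_gt_atTop 0] with t ht
    have ht' : (0 : ℝ) < t := ht
    have hq := CAT0Space.sq_dist_diagonals_le y x (γ t) (γ' t)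
    have hc : dist (γ t) (γ' t) ^ 2 ≤ C ^ 2 := by gcongr; exact hC t
    rw [dist_comm (γ' t), dist_comm y x] at hq
    rw [mul_one_div, div_div, le_div_iff₀ (by positivity)]
    nlinarith)
  linarith

theorem busemann_sub_busemann_eq {γ γ' : GeodesicRay M} (h : γ ≈ γ') (x y : M) :
    γ.busemann x - γ.busemann y = γ'.busemann x - γ'.busemann y :=
  (busemann_sub_busemann_le h x y).antisymm (busemann_sub_busemann_le (Setoid.symm h) x y)

/-- The Busemann function depends continuously on the ray, the origin of which may vary. -/
theorem continuous_busemann (x : M) : Continuous fun γ : GeodesicRay M => γ.busemann x := by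
  have h0 : Continuous fun γ : GeodesicRay M => dist x (γ 0) :=
    continuous_const.dist (continuous_eval 0)
  refine continuous_iff_continuousAt.2 fun γ => ?_
  refine continuousAt_of_locally_uniform_approx_of_continuousAt fun u hu => ?_
  obtain ⟨ε, hε, hu⟩ := Metric.mem_uniformity_dist.1 hu
  set R := dist x (γ 0) + 1
  have hR : 0 < R := by positivity
  set t : ℝ≥0 := ⟨R ^ 2 / ε, by positivity⟩
  have ht : (t : ℝ) = R ^ 2 / ε := rfl
  have ht0 : 0 < t := by rw [← NNReal.coe_pos, ht]; positivity
  refine ⟨_, h0.continuousAt.eventually (gt_mem_nhds (lt_add_one _)),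
    fun η => (t : ℝ) - dist x (η t),
    (continuous_const.sub (continuous_const.dist (continuous_eval t))).continuousAt,
    fun η hη => hu ?_⟩
  have h1 := η.sub_dist_le_busemann x t
  have h2 := η.busemann_le x ht0
  have h3 : dist x (η 0) ^ 2 / (2 * t) ≤ R ^ 2 / (2 * t) := by
    gcongr
    exact le_of_lt hη
  have h4 : R ^ 2 / (2 * t) = ε / 2 := by rw [ht]; field_simp
  rw [Real.dist_eq, abs_of_nonneg (sub_nonneg.2 h1)]
  linarith

end GeodesicRay

/-! ### The boundary at infinity -/

namespace GeodesicRay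

/-- Maps that eventually preserve each distance and are bounded at each point have a geodesic ray
as their pointwise limit along an ultrafilter. -/
theorem exists_tendsto_ultrafilter [ProperSpace M] {ι : Type*} (f : Ultrafilter ι)
    (c : ι → ℝ≥0 → M) (p : M) (R : ℝ≥0 → ℝ)
    (hp : ∀ s, ∀ᶠ i in (f : Filter ι), dist (c i s) p ≤ R s)
    (hc : ∀ s t, ∀ᶠ i in (f : Filter ι), dist (c i s) (c i t) = dist s t) :
    ∃ γ : GeodesicRay M, ∀ s, Tendsto (fun i => c i s) f (𝓝 (γ s)) := by
  have H : ∀ s, ∃ y, Tendsto (fun i => c i s) f (𝓝 y) := fun s => by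
    obtain ⟨y, -, hy⟩ := (isCompact_closedBall p (R s)).ultrafilter_le_nhds
      (f.map fun i => c i s) (by
        rw [le_principal_iff]
        exact hp s)
    exact ⟨y, hy⟩
  choose γ hγ using H
  refine ⟨⟨γ, Isometry.of_dist_eq fun s t => ?_⟩, hγ⟩
  exact tendsto_nhds_unique ((hγ s).dist (hγ t))
    (tendsto_const_nhds.congr' ((hc s t).mono fun i hi => hi.symm))

/-- Pointwise convergence of geodesic rays implies convergence uniformly on compact sets, because
rays are `1`-Lipschitz. -/
theorem tendsto_of_tendsto_eval {ι : Type*} {f : Filter ι} {c : ι → GeodesicRay M}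
    {γ : GeodesicRay M} (h : ∀ s, Tendsto (fun i => c i s) f (𝓝 (γ s))) :
    Tendsto c f (𝓝 γ) := by
  rw [nhds_induced, tendsto_comap_iff, ContinuousMap.tendsto_iff_tendstoLocallyUniformly,
    Metric.tendstoLocallyUniformly_iff]
  intro ε hε s
  refine ⟨_, Metric.ball_mem_nhds s (div_pos hε three_pos), ?_⟩
  filter_upwards [Metric.tendsto_nhds.1 (h s) _ (div_pos hε three_pos)] with i hi t ht
  change dist (γ t) (c i t) < ε
  have h1 := dist_triangle4 (γ t) (γ s) (c i s) (c i t)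
  rw [γ.isometry.dist_eq, (c i).isometry.dist_eq, dist_comm s t, dist_comm (γ s)] at h1
  rw [Metric.mem_ball] at ht
  linarith

variable [CAT0Space M]

/-- In a proper `CAT(0)` space, every ray is asymptotic to a ray issuing from a given point `p`:
a limit of the segments from `p` to the points of the ray. -/
theorem exists_asymptotic_from [ProperSpace M] (γ : GeodesicRay M) (p : M) :
    ∃ η : GeodesicRay M, η 0 = p ∧ η ≈ γ := by
  set D := dist p (γ 0)
  have hD : 0 ≤ D := dist_nonneg
  have hd : ∀ n : ℕ, |(n : ℝ) - dist p (γ n)| ≤ D := fun n => by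
    simpa using γ.abs_sub_dist_le p n
  choose σ hσ0 hσ1 hσ using fun n : ℕ => CAT0Space.exists_geodesic p (γ n)
  set d : ℕ → ℝ := fun n => dist p (γ n)
  set c : ℕ → ℝ≥0 → M := fun n s => σ n (s / d n)
  have hlarge : ∀ s : ℝ≥0, ∀ᶠ n in atTop, 0 < d n ∧ (s : ℝ) ≤ d n := fun s => by
    filter_upwards [tendsto_natCast_atTop_atTop.eventually_gt_atTop (D + s)] with n hn
    have h1 := (abs_le.1 (hd n)).2
    have h2 := s.2
    constructor <;> linarith
  have hmem : ∀ (s : ℝ≥0) (n : ℕ), 0 < d n → (s : ℝ) ≤ d n → (s : ℝ) / d n ∈ Set.Icc (0 : ℝ) 1 :=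
    fun s n h0 h1 => ⟨by positivity, (div_le_one h0).2 h1⟩
  have hdist : ∀ s t : ℝ≥0, ∀ᶠ n in atTop, dist (c n s) (c n t) = dist s t := fun s t => by
    filter_upwards [hlarge s, hlarge t] with n hs ht
    rw [hσ n _ (hmem s n hs.1 hs.2) _ (hmem t n ht.1 ht.2), NNReal.dist_eq, ← sub_div,
      abs_div, abs_of_pos hs.1]
    exact div_mul_cancel₀ _ hs.1.ne'
  have hzero : ∀ n, c n 0 = p := fun n => by simp [c, hσ0]
  have hclose : ∀ s : ℝ≥0, ∀ᶠ n in atTop, dist (c n s) (γ s) ≤ 2 * D := fun s => by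
    filter_upwards [hlarge s] with n hs
    obtain ⟨hu0, hu1⟩ := hmem s n hs.1 hs.2
    set u := (s : ℝ) / d n
    have hs' : (s : ℝ) = u * d n := (div_mul_cancel₀ _ hs.1.ne').symm
    set v : ℝ≥0 := ⟨u * n, by positivity⟩
    have hv : (v : ℝ) = u * n := rfl
    have h1 : dist (c n s) (γ v) ≤ (1 - u) * D := by
      refine CAT0Space.dist_le_of_common_ratio (z := γ n) hu0 hu1 ?_ ?_ ?_ ?_
      · have := hσ n 0 ⟨le_rfl, zero_le_one⟩ u ⟨hu0, hu1⟩
        rwa [hσ0, zero_sub, abs_neg, abs_of_nonneg hu0] at this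
      · have := hσ n u ⟨hu0, hu1⟩ 1 ⟨zero_le_one, le_rfl⟩
        rwa [hσ1, abs_sub_comm, abs_of_nonneg (sub_nonneg.2 hu1)] at this
      · rw [dist_zero, dist_zero, hv]; simp
      · rw [dist_zero, dist_eq, hv, abs_sub_comm]
        simp only [NNReal.coe_natCast]
        rw [abs_of_nonneg] <;> nlinarith
    have h2 : dist (γ v) (γ s) ≤ u * D := by
      rw [dist_eq, hv, hs', ← mul_sub, abs_mul, abs_of_nonneg hu0]
      exact mul_le_mul_of_nonneg_left (hd n) hu0
    have := dist_triangle (c n s) (γ v) (γ s)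
    nlinarith
  obtain ⟨η, hη⟩ := exists_tendsto_ultrafilter (hyperfilter ℕ) c p (fun s => s) (fun s => by
      refine Nat.hyperfilter_le_atTop ((hdist s 0).mono fun n hn => ?_)
      rw [hzero] at hn
      rw [hn]
      simp [NNReal.dist_eq])
    (fun s t => Nat.hyperfilter_le_atTop (hdist s t))
  refine ⟨η, ?_, 2 * D, fun s => ?_⟩
  · refine tendsto_nhds_unique (hη 0) ?_
    simp only [hzero]
    exact tendsto_const_nhds
  · exact le_of_tendsto ((hη s).dist tendsto_const_nhds) (Nat.hyperfilter_le_atTop (hclose s))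

end GeodesicRay

namespace Boundary

theorem continuous_mk : Continuous (mk : GeodesicRay M → Boundary M) := continuous_coinduced_rng

/-- The boundary of a proper `CAT(0)` space is compact, being the continuous image of the compact
space of rays issuing from a base point. -/
instance compactSpace [CAT0Space M] [ProperSpace M] : CompactSpace (Boundary M) := by
  rcases isEmpty_or_nonempty M with hM | ⟨⟨p⟩⟩
  · refine ⟨?_⟩
    convert isCompact_empty
    refine Set.eq_empty_of_forall_notMem fun e _ => ?_
    induction e using Quotient.inductionOn with
    | h γ => exact hM.elim (γ 0)
  have hK : IsCompact {γ : GeodesicRay M | γ 0 = p} := by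
    rw [isCompact_iff_ultrafilter_le_nhds]
    intro f hf
    obtain ⟨γ, hγ⟩ := GeodesicRay.exists_tendsto_ultrafilter f (fun γ => γ) p (fun s => s)
      (fun s => by
        filter_upwards [le_principal_iff.1 hf] with γ hγ
        rw [← show γ 0 = p from hγ, dist_comm, γ.dist_zero])
      (fun s t => Eventually.of_forall fun γ => γ.isometry.dist_eq s t)
    refine ⟨γ, ?_, GeodesicRay.tendsto_of_tendsto_eval (c := id) hγ⟩
    refine tendsto_nhds_unique (hγ 0) (tendsto_const_nhds.congr' ?_)
    filter_upwards [le_principal_iff.1 hf] with η hη using hη.symm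
  refine ⟨?_⟩
  convert hK.image continuous_mk
  refine (Set.eq_univ_of_forall fun e => ?_).symm
  induction e using Quotient.inductionOn with
  | h γ =>
    obtain ⟨η, h0, hη⟩ := γ.exists_asymptotic_from p
    exact ⟨η, h0, Quotient.sound hη⟩

instance {G : Type*} [Group G] [MulAction G M] [IsIsometricSMul G M] :
    ContinuousConstSMul G (Boundary M) := by
  refine ⟨fun g => continuous_coinduced_dom.2 ?_⟩
  have h : Continuous fun γ : GeodesicRay M => g • γ :=
    continuous_iff_continuousAt.2 fun γ => GeodesicRay.tendsto_of_tendsto_eval fun s =>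
      ((GeodesicRay.continuous_eval s).const_smul g).continuousAt
  exact continuous_mk.comp h

variable [CAT0Space M]

/-- The difference `β_e(p) - β_e(q)` of the values of a Busemann function at two points. It depends
only on the endpoint `e` of the ray. -/
def busemannDiff (p q : M) (e : Boundary M) : ℝ :=
  Quotient.lift (fun γ : GeodesicRay M => γ.busemann p - γ.busemann q)
    (fun _ _ h => GeodesicRay.busemann_sub_busemann_eq h p q) e

theorem busemannDiff_mk (p q : M) (γ : GeodesicRay M) :
    busemannDiff p q (mk γ) = γ.busemann p - γ.busemann q := rfl

theorem continuous_busemannDiff (p q : M) : Continuous (busemannDiff p q) :=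
  continuous_coinduced_dom.2
    ((GeodesicRay.continuous_busemann p).sub (GeodesicRay.continuous_busemann q))

theorem busemannDiff_smul {G : Type*} [Group G] [MulAction G M] [IsIsometricSMul G M] (g : G)
    (p q : M) (e : Boundary M) : busemannDiff (g • p) (g • q) (g • e) = busemannDiff p q e := by
  induction e using Quotient.inductionOn with
  | h γ =>
    change (g • γ).busemann (g • p) - (g • γ).busemann (g • q) = γ.busemann p - γ.busemann q
    rw [GeodesicRay.busemann_smul, GeodesicRay.busemann_smul]

end Boundary

end Geometry

/-! ### Additive maps on free modules and volleys -/

section Algebra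

variable {G X : Type*} [Group G]

section Action

variable {A : Type*} [AddCommGroup A] [Module (MonoidAlgebra ℤ G) A]

theorem gact_one (a : A) : gact (1 : G) a = a := by
  rw [gact, ← MonoidAlgebra.one_def, one_smul]

theorem gact_mul (g g' : G) (a : A) : gact (g * g') a = gact g (gact g' a) := by
  rw [gact, gact, gact, smul_smul, MonoidAlgebra.single_mul_single, one_mul]

theorem gact_inv_gact (g : G) (a : A) : gact g⁻¹ (gact g a) = a := by
  rw [← gact_mul, inv_mul_cancel, gact_one]

theorem gact_gact_inv (g : G) (a : A) : gact g (gact g⁻¹ a) = a := by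
  rw [← gact_mul, mul_inv_cancel, gact_one]

variable (A) in
/-- The action of a group element as an additive endomorphism. -/
def gactHom (g : G) : A →+ A := DistribSMul.toAddMonoidHom A (MonoidAlgebra.single g (1 : ℤ))

theorem gactHom_apply (g : G) (a : A) : gactHom A g a = gact g a := rfl

end Action

namespace FreeMod

/-- The element `gx` of the `ℤ`-basis `GX` of the free module. -/
def basisElt (x : X) (g : G) : FreeMod G X := Finsupp.single x (MonoidAlgebra.single g 1)

theorem gact_basisElt (x : X) (g k : G) : gact g (basisElt x k) = basisElt x (g * k) := by
  rw [gact, basisElt, basisElt, Finsupp.smul_single, smul_eq_mul, MonoidAlgebra.single_mul_single,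
    one_mul]

theorem coeff_gact (g k : G) (c : FreeMod G X) (x : X) :
    ((gact g c) x).coeff k = (c x).coeff (g⁻¹ * k) := by
  rw [gact, Finsupp.smul_apply, smul_eq_mul, MonoidAlgebra.coeff_single_mul_apply, one_mul]

variable {B : Type*} [AddCommGroup B]

theorem addHom_ext {φ ψ : FreeMod G X →+ B}
    (h : ∀ x g, φ (basisElt x g) = ψ (basisElt x g)) : φ = ψ := by
  refine Finsupp.addHom_ext' fun x => MonoidAlgebra.addMonoidHom_ext fun g => ?_
  exact DFunLike.congr_fun (AddMonoidHom.ext_int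
    (f := (φ.comp (Finsupp.singleAddHom x)).comp (MonoidAlgebra.singleAddHom g))
    (g := (ψ.comp (Finsupp.singleAddHom x)).comp (MonoidAlgebra.singleAddHom g)) (h x g))

/-- The additive map that takes prescribed values on the `ℤ`-basis `GX`. -/
def ofBasis (f : X → G → B) : FreeMod G X →+ B :=
  Finsupp.liftAddHom fun x => (Finsupp.liftAddHom fun g => zmultiplesHom B (f x g)).comp
    (MonoidAlgebra.coeffAddEquiv (R := ℤ) (M := G)).toAddMonoidHom

theorem ofBasis_apply (f : X → G → B) (c : FreeMod G X) :
    ofBasis f c = c.sum fun x a => a.coeff.sum fun g n => n • f x g := rfl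

theorem ofBasis_single (f : X → G → B) (x : X) (g : G) (n : ℤ) :
    ofBasis f (Finsupp.single x (MonoidAlgebra.single g n)) = n • f x g := by
  rw [ofBasis_apply, Finsupp.sum_single_index, MonoidAlgebra.coeff_single]
  · exact Finsupp.sum_single_index (zero_smul ℤ _)
  · rw [MonoidAlgebra.coeff_zero, Finsupp.sum_zero_index]

theorem ofBasis_basisElt (f : X → G → B) (x : X) (g : G) :
    ofBasis f (basisElt x g) = f x g := by
  rw [basisElt, ofBasis_single, one_smul]

/-- The volley whose selections are the additive maps that send each basis element `gx` into
`g S(x)`. -/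
def volley (S : X → Set (FreeMod G X)) (c : FreeMod G X) : Set (FreeMod G X) :=
  {d | ∃ f : X → G → FreeMod G X, (∀ x g, f x g ∈ gact g '' S x) ∧ ofBasis f c = d}

theorem finite_volley {S : X → Set (FreeMod G X)} (hS : ∀ x, (S x).Finite) (c : FreeMod G X) :
    (volley S c).Finite := by
  have hadd : ∀ a b : FreeMod G X, (volley S a).Finite → (volley S b).Finite →
      (volley S (a + b)).Finite := fun a b ha hb => by
    refine (Set.Finite.image2 (· + ·) ha hb).subset ?_
    rintro _ ⟨f, hf, rfl⟩
    exact ⟨_, ⟨f, hf, rfl⟩, _, ⟨f, hf, rfl⟩, (map_add _ _ _).symm⟩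
  have hzero : (volley S (0 : FreeMod G X)).Finite := by
    refine (Set.finite_singleton 0).subset ?_
    rintro _ ⟨f, -, rfl⟩
    exact map_zero _
  induction c using Finsupp.induction_linear with
  | zero => exact hzero
  | add a b ha hb => exact hadd a b ha hb
  | single x a =>
    induction a using MonoidAlgebra.induction_linear with
    | zero => rw [Finsupp.single_zero]; exact hzero
    | add a b ha hb => rw [Finsupp.single_add]; exact hadd _ _ ha hb
    | single g n =>
      refine (((hS x).image (gact g)).image (n • ·)).subset ?_
      rintro _ ⟨f, hf, rfl⟩
      exact ⟨_, hf x g, (ofBasis_single f x g n).symm⟩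

theorem gact_mem_volley {S : X → Set (FreeMod G X)} (g : G) {c d : FreeMod G X}
    (hd : d ∈ volley S c) : gact g d ∈ volley S (gact g c) := by
  obtain ⟨f, hf, rfl⟩ := hd
  refine ⟨fun x k => gact g (f x (g⁻¹ * k)), fun x k => ?_, ?_⟩
  · obtain ⟨s, hs, h⟩ := hf x (g⁻¹ * k)
    refine ⟨s, hs, ?_⟩
    dsimp only
    rw [← h, ← gact_mul, mul_inv_cancel_left]
  · have : (ofBasis fun x k => gact g (f x (g⁻¹ * k))).comp (gactHom (FreeMod G X) g) =
        (gactHom (FreeMod G X) g).comp (ofBasis f) := by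
      refine addHom_ext fun x k => ?_
      simp only [AddMonoidHom.comp_apply, gactHom_apply, gact_basisElt, ofBasis_basisElt,
        inv_mul_cancel_left]
    exact DFunLike.congr_fun this c

theorem isVolley_volley {S : X → Set (FreeMod G X)} (hS : ∀ x, (S x).Finite) :
    IsVolley G (volley S) where
  finite := finite_volley hS
  equivariant g c := by
    refine Set.Subset.antisymm (fun d hd => ?_) ?_
    · refine ⟨gact g⁻¹ d, ?_, gact_gact_inv g d⟩
      simpa only [gact_inv_gact] using gact_mem_volley g⁻¹ hd
    · rintro _ ⟨d, hd, rfl⟩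
      exact gact_mem_volley g hd

end FreeMod

end Algebra

/-! ### Control maps and guaranteed shifts -/

namespace ControlledPresentation

open FreeMod

variable {G A M X X' : Type*} [Group G] [AddCommGroup A] [Module (MonoidAlgebra ℤ G) A]

theorem ε_gact (P : ControlledPresentation G A M X) (g : G) (c : FreeMod G X) :
    P.ε (gact g c) = gact g (P.ε c) := map_smul P.ε _ c

theorem ε_ofBasis (P : ControlledPresentation G A M X) (Q : ControlledPresentation G A M X')
    {f : X → G → FreeMod G X'} (hf : ∀ x g, Q.ε (f x g) = P.ε (basisElt x g))
    (c : FreeMod G X) : Q.ε (ofBasis f c) = P.ε c := by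
  have : Q.ε.toAddMonoidHom.comp (ofBasis f) = P.ε.toAddMonoidHom := by
    refine addHom_ext fun x g => ?_
    change Q.ε (ofBasis f _) = P.ε _
    rw [ofBasis_basisElt, hf]
  exact DFunLike.congr_fun this c

variable [MulAction G M] (P : ControlledPresentation G A M X)

theorem h_zero : P.h 0 = ∅ := by
  refine Set.eq_empty_of_forall_notMem ?_
  rintro p ⟨x, g, hg, -⟩
  simp at hg

theorem h_add_subset (a b : FreeMod G X) : P.h (a + b) ⊆ P.h a ∪ P.h b := by
  rintro p ⟨x, g, hg, hp⟩
  rw [Finsupp.add_apply, MonoidAlgebra.coeff_add, Finsupp.add_apply] at hg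
  by_cases ha : (a x).coeff g = 0
  · rw [ha, zero_add] at hg
    exact Or.inr ⟨x, g, hg, hp⟩
  · exact Or.inl ⟨x, g, ha, hp⟩

theorem h_zsmul_subset (n : ℤ) (a : FreeMod G X) : P.h (n • a) ⊆ P.h a := by
  rintro p ⟨x, g, hg, hp⟩
  refine ⟨x, g, fun h0 => hg ?_, hp⟩
  rw [Finsupp.smul_apply, MonoidAlgebra.coeff_smul, Finsupp.smul_apply, h0, smul_zero]

theorem exists_mem_h_of_mem_h_sum {ι : Type*} {s : Finset ι} {f : ι → FreeMod G X} {p : M}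
    (hp : p ∈ P.h (∑ i ∈ s, f i)) : ∃ i ∈ s, p ∈ P.h (f i) := by
  classical
  induction s using Finset.induction_on with
  | empty => rw [Finset.sum_empty, h_zero] at hp; exact hp.elim
  | insert i s hi ih =>
    rw [Finset.sum_insert hi] at hp
    rcases P.h_add_subset _ _ hp with hp | hp
    · exact ⟨i, Finset.mem_insert_self i s, hp⟩
    · obtain ⟨j, hj, hp⟩ := ih hp
      exact ⟨j, Finset.mem_insert_of_mem hj, hp⟩

theorem exists_mem_h_of_mem_h_ofBasis {f : X' → G → FreeMod G X} {c : FreeMod G X'} {p : M}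
    (hp : p ∈ P.h (ofBasis f c)) : ∃ x g, (c x).coeff g ≠ 0 ∧ p ∈ P.h (f x g) := by
  rw [ofBasis_apply] at hp
  obtain ⟨x, -, hp⟩ := P.exists_mem_h_of_mem_h_sum hp
  obtain ⟨g, hg, hp⟩ := P.exists_mem_h_of_mem_h_sum hp
  exact ⟨x, g, Finsupp.mem_support_iff.1 hg, P.h_zsmul_subset _ _ hp⟩

theorem smul_mem_h_gact {c : FreeMod G X} {p : M} (g : G) (hp : p ∈ P.h c) :
    g • p ∈ P.h (gact g c) := by
  obtain ⟨x, k, hk, q, hq, rfl⟩ := hp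
  refine ⟨x, g * k, ?_, q, hq, (mul_smul g k q).symm⟩
  rwa [coeff_gact, inv_mul_cancel_left]

theorem inv_smul_mem_h_of_mem_h_gact {c : FreeMod G X} {p : M} {g : G} (hp : p ∈ P.h (gact g c)) :
    g⁻¹ • p ∈ P.h c := by
  simpa only [gact_inv_gact] using P.smul_mem_h_gact g⁻¹ hp

variable [MetricSpace M]

/-- The guaranteed shift is at least `δ` if and only if each point of the control set of `φ c`
lies deeper, by at least `δ`, than some point of the control set of `c`. -/
theorem le_gsh_iff (γ : GeodesicRay M) (φ : FreeMod G X →+ FreeMod G X) (δ : ℝ) :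
    (δ : EReal) ≤ P.gsh γ φ ↔
      ∀ c, ∀ p ∈ P.h (φ c), ∃ q ∈ P.h c, δ ≤ γ.busemann p - γ.busemann q := by
  rw [gsh, le_iInf₂_iff]
  refine forall_congr' fun c => ?_
  rcases eq_or_ne c 0 with rfl | hc
  · simp [h_zero]
  obtain ⟨q, hq, hmin⟩ := Set.exists_min_image _ γ.busemann (P.finite_h c) (P.nonempty_h hc)
  have hval : P.val γ c = (γ.busemann q : EReal) :=
    le_antisymm (iInf₂_le q hq) (le_iInf₂ fun p hp => EReal.coe_le_coe_iff.2 (hmin p hp))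
  rw [hval, EReal.le_sub_iff_add_le (Or.inl (EReal.coe_ne_bot _)) (Or.inl (EReal.coe_ne_top _)),
    val, le_iInf₂_iff, ← EReal.coe_add]
  simp only [EReal.coe_le_coe_iff, ne_eq, hc, not_false_eq_true, forall_const]
  refine forall₂_congr fun p _ => ⟨fun h => ⟨q, hq, by linarith⟩, ?_⟩
  rintro ⟨q', hq', h⟩
  have := hmin q' hq'
  linarith

variable [IsIsometricSMul G M]

/-! ### The horospherical limit set -/

/-- A lift of the identity of `A` to the free modules moves control sets by a bounded distance, so
the horospherical limit set does not depend on the presentation. -/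
theorem horosphericalLimitSet_subset [Finite X] (Q : ControlledPresentation G A M X') :
    P.horosphericalLimitSet ⊆ Q.horosphericalLimitSet := by
  intro e he γ hγ t a
  choose b hb using fun x => Q.surjective (P.ε (basisElt x (1 : G)))
  choose q hq using P.nonempty
  have hD : ∃ D : ℝ, ∀ x, ∀ p ∈ Q.h (b x), dist p (q x) ≤ D := by
    choose D hD using fun x => ((Q.finite_h (b x)).image (dist · (q x))).bddAbove
    obtain ⟨D', hD'⟩ := (Set.finite_range D).bddAbove
    exact ⟨D', fun x p hp => (hD x ⟨p, hp, rfl⟩).trans (hD' ⟨x, rfl⟩)⟩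
  obtain ⟨D, hD⟩ := hD
  obtain ⟨c, rfl, hc⟩ := he γ hγ (t + D) a
  refine ⟨ofBasis (fun x g => gact g (b x)) c, ε_ofBasis P Q (fun x g => ?_) c, fun p hp => ?_⟩
  · rw [ε_gact, hb, ← ε_gact, gact_basisElt, mul_one]
  · obtain ⟨x, g, hg, hp⟩ := Q.exists_mem_h_of_mem_h_ofBasis hp
    have h1 : t + D ≤ γ.busemann (g • q x) := hc ⟨x, g, hg, q x, hq x, rfl⟩
    have h2 := hD x _ (Q.inv_smul_mem_h_of_mem_h_gact hp)
    rw [← dist_smul g, smul_inv_smul, dist_comm] at h2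
    have h3 := γ.busemann_sub_le_dist (g • q x) p
    change t ≤ γ.busemann p
    linarith

theorem horosphericalLimitSet_eq [Finite X] [Finite X'] (Q : ControlledPresentation G A M X') :
    P.horosphericalLimitSet = Q.horosphericalLimitSet :=
  (P.horosphericalLimitSet_subset Q).antisymm (Q.horosphericalLimitSet_subset P)

variable [CAT0Space M]

open Boundary

/-- The translates of a `G`-finitary endomorphism pushing towards `e` are selections from one
volley and push towards the points of `Ge`. Their `n`-fold iterates take a given element `c₀` into
one finite set, so the translates for points of `Ge` close to `e'` push `c₀` towards `e'`. -/
theorem closure_orbit_subset_horosphericalLimitSet {e : Boundary M}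
    (he : e ∈ P.finitaryLimitSet) :
    closure (MulAction.orbit G e) ⊆ P.horosphericalLimitSet := by
  rintro _ he' γ' rfl t a
  obtain ⟨φ, ⟨Φ, hΦ, hφ⟩, hε, hgsh⟩ := he
  obtain ⟨δ, hδ0, hδ⟩ : ∃ δ : ℝ, 0 < δ ∧
      ∀ c, ∀ p ∈ P.h (φ c), ∃ q ∈ P.h c, δ ≤ busemannDiff p q e := by
    induction e using Quotient.inductionOn with
    | h γ =>
      obtain ⟨δ, h0, h1⟩ := EReal.lt_iff_exists_real_btwn.1 (hgsh γ rfl)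
      exact ⟨δ, EReal.coe_pos.1 h0, (P.le_gsh_iff γ φ δ).1 h1.le⟩
  obtain ⟨c₀, rfl⟩ := P.surjective a
  obtain ⟨m, hm⟩ := ((P.finite_h c₀).image γ'.busemann).bddBelow
  obtain ⟨n, hn⟩ := exists_nat_gt ((t - m + 1) / δ)
  rw [div_lt_iff₀ hδ0] at hn
  let T : ℕ → Set (FreeMod G X) := fun k => Nat.rec {c₀} (fun _ S => ⋃ c ∈ S, Φ c) k
  have hT : ∀ k, (T k).Finite := fun k => by
    induction k with
    | zero => exact Set.finite_singleton c₀
    | succ k ih => exact ih.biUnion fun c _ => hΦ.finite c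
  have hnear : ∀ᶠ e'' in 𝓝 (Boundary.mk γ'), ∀ p ∈ ⋃ c ∈ T n, P.h c, ∀ q ∈ P.h c₀,
      busemannDiff p q e'' < busemannDiff p q (Boundary.mk γ') + 1 := by
    rw [eventually_all_finite ((hT n).biUnion fun c _ => P.finite_h c)]
    intro p _
    rw [eventually_all_finite (P.finite_h c₀)]
    exact fun q _ => (continuous_busemannDiff p q).continuousAt.eventually
      (gt_mem_nhds (lt_add_one _))
  obtain ⟨_, ⟨g, rfl⟩, hg⟩ := (mem_closure_iff_frequently.1 he').and_eventually hnear |>.exists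
  let ψ : FreeMod G X → FreeMod G X := fun c => gact g (φ (gact g⁻¹ c))
  have hψmem : ∀ c, ψ c ∈ Φ c := fun c => by
    have := hΦ.equivariant g (gact g⁻¹ c)
    rw [gact_gact_inv] at this
    rw [this]
    exact ⟨_, hφ _, rfl⟩
  have hψε : ∀ c, P.ε (ψ c) = P.ε c := fun c => by
    rw [P.ε_gact, hε, ← P.ε_gact, gact_gact_inv]
  have hψδ : ∀ c, ∀ p ∈ P.h (ψ c), ∃ q ∈ P.h c, δ ≤ busemannDiff p q (g • e) := fun c p hp => by
    obtain ⟨q, hq, h⟩ := hδ _ _ (P.inv_smul_mem_h_of_mem_h_gact hp)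
    refine ⟨g • q, ?_, ?_⟩
    · simpa only [gact_gact_inv] using P.smul_mem_h_gact g hq
    · rwa [← busemannDiff_smul g, smul_inv_smul] at h
  have hiter : ∀ k : ℕ, ψ^[k] c₀ ∈ T k ∧ P.ε (ψ^[k] c₀) = P.ε c₀ ∧
      ∀ p ∈ P.h (ψ^[k] c₀), ∃ q ∈ P.h c₀, k * δ ≤ busemannDiff p q (g • e) := fun k => by
    induction k with
    | zero => exact ⟨rfl, rfl, fun p hp => ⟨p, hp, by
        induction e using Quotient.inductionOn with
        | h γ => simp [smul_mk, show (⟦γ⟧ : Boundary M) = Boundary.mk γ from rfl, busemannDiff_mk]⟩⟩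
    | succ k ih =>
      rw [Function.iterate_succ_apply']
      refine ⟨Set.mem_biUnion ih.1 (hψmem _), (hψε _).trans ih.2.1, fun p hp => ?_⟩
      obtain ⟨q, hq, h1⟩ := hψδ _ p hp
      obtain ⟨q', hq', h2⟩ := ih.2.2 q hq
      refine ⟨q', hq', ?_⟩
      have h3 : busemannDiff p q' (g • e) =
          busemannDiff p q (g • e) + busemannDiff q q' (g • e) := by
        generalize g • e = e₁
        induction e₁ using Quotient.inductionOn with
        | h γ => exact (sub_add_sub_cancel _ _ _).symm
      push_cast
      linarith
  obtain ⟨h1, h2, h3⟩ := hiter n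
  refine ⟨ψ^[n] c₀, h2, fun p hp => ?_⟩
  obtain ⟨q, hq, h4⟩ := h3 p hp
  have h5 := hg p (Set.mem_biUnion h1 hp) q hq
  have h6 : m ≤ γ'.busemann q := hm ⟨q, hq, rfl⟩
  rw [busemannDiff_mk] at h5
  change t ≤ γ'.busemann p
  change busemannDiff p q (g • e) < _ at h5
  linarith

/-! ### Uniform pushing towards closed invariant sets -/

/-- If `A` is supported over all horoballs at the points of a closed invariant set `E`, then by
compactness of `E` finitely many lifts of the generators suffice to push towards all points of `E`
at once. -/
theorem exists_volley_of_subset_horosphericalLimitSet [Finite X] [ProperSpace M]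
    {E : Set (Boundary M)} (hE : IsClosed E) (hG : ∀ (g : G), ∀ e ∈ E, g • e ∈ E)
    (hsub : E ⊆ P.horosphericalLimitSet) :
    ∃ (ν : ℝ) (Φ : FreeMod G X → Set (FreeMod G X)), 0 < ν ∧ IsVolley G Φ ∧
      (∀ c, P.ε '' Φ c = {P.ε c}) ∧
      ∀ e ∈ E, ∃ φ : FreeMod G X →+ FreeMod G X, IsSelection φ Φ ∧
        ∀ γ : GeodesicRay M, Boundary.mk γ = e → (ν : EReal) ≤ P.gsh γ φ := by
  choose q hq using P.nonempty
  have hlift : ∀ e : Boundary M, ∃ C : X → FreeMod G X, e ∈ E →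
      ∀ x, P.ε (C x) = P.ε (basisElt x (1 : G)) ∧
        ∀ p ∈ P.h (C x), 1 < busemannDiff p (q x) e := fun e => by
    by_cases he : e ∈ E
    · have h := hsub he
      induction e using Quotient.inductionOn with
      | h γ =>
        choose C hC hC' using fun x =>
          h γ rfl (γ.busemann (q x) + 2) (P.ε (basisElt x (1 : G)))
        refine ⟨C, fun _ x => ⟨hC x, fun p hp => ?_⟩⟩
        have h2 : γ.busemann (q x) + 2 ≤ γ.busemann p := hC' x hp
        change 1 < γ.busemann p - γ.busemann (q x)
        linarith
    · exact ⟨0, fun h => (he h).elim⟩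
  choose C hC using hlift
  let U : Boundary M → Set (Boundary M) :=
    fun e => {e' | ∀ x, ∀ p ∈ P.h (C e x), 1 < busemannDiff p (q x) e'}
  have hU : ∀ e ∈ E, U e ∈ 𝓝 e := fun e he => by
    refine eventually_all.2 fun x => (eventually_all_finite (P.finite_h _)).2 fun p hp => ?_
    exact (continuous_busemannDiff p (q x)).continuousAt.eventually
      (lt_mem_nhds ((hC e he x).2 p hp))
  obtain ⟨I, hIE, hI⟩ := hE.isCompact.elim_nhds_subcover U hU
  -- The generators themselves are added so that every volley value is non-empty, even for `E = ∅`.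
  let S : X → Set (FreeMod G X) := fun x => insert (basisElt x 1) ((fun e => C e x) '' I)
  have hS : ∀ x, (S x).Finite := fun x => (I.finite_toSet.image _).insert _
  have hSε : ∀ x, ∀ s ∈ S x, P.ε s = P.ε (basisElt x (1 : G)) := fun x s hs => by
    rcases hs with rfl | ⟨e, he, rfl⟩
    · rfl
    · exact (hC e (hIE e he) x).1
  refine ⟨1, volley S, one_pos, isVolley_volley hS, fun c => ?_, fun e he => ?_⟩
  · refine Set.Subset.antisymm ?_ ?_
    · rintro _ ⟨_, ⟨f, hf, rfl⟩, rfl⟩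
      refine ε_ofBasis P P (fun x g => ?_) c
      obtain ⟨s, hs, h⟩ := hf x g
      rw [← h, ε_gact, hSε x s hs, ← ε_gact, gact_basisElt, mul_one]
    · rintro _ rfl
      exact ⟨_, ⟨fun x g => gact g (basisElt x 1),
        fun x g => ⟨_, Set.mem_insert _ _, rfl⟩, rfl⟩,
        ε_ofBasis P P (fun x g => by rw [gact_basisElt, mul_one]) c⟩
  · have hcov : ∀ g : G, ∃ i ∈ I, g⁻¹ • e ∈ U i := fun g => by
      simpa only [Set.mem_iUnion, exists_prop] using hI (hG g⁻¹ e he)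
    choose i hi hiU using hcov
    let f : X → G → FreeMod G X := fun x g => gact g (C (i g) x)
    refine ⟨ofBasis f, fun c => ⟨f, fun x g => ⟨_, Set.mem_insert_of_mem _
      ⟨i g, hi g, rfl⟩, rfl⟩, rfl⟩, ?_⟩
    rintro γ rfl
    refine (P.le_gsh_iff γ _ 1).2 fun c p hp => ?_
    obtain ⟨x, g, hg, hp⟩ := P.exists_mem_h_of_mem_h_ofBasis hp
    refine ⟨g • q x, ⟨x, g, hg, q x, hq x, rfl⟩, ?_⟩
    have h := hiU g x _ (P.inv_smul_mem_h_of_mem_h_gact hp)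
    rw [← busemannDiff_smul g, smul_inv_smul, smul_inv_smul] at h
    exact h.le

theorem subset_finitaryLimitSet [Finite X] [ProperSpace M]
    {E : Set (Boundary M)} (hE : IsClosed E) (hG : ∀ (g : G), ∀ e ∈ E, g • e ∈ E)
    (hsub : E ⊆ P.horosphericalLimitSet) : E ⊆ P.finitaryLimitSet := by
  obtain ⟨ν, Φ, hν, hΦ, hε, h⟩ := P.exists_volley_of_subset_horosphericalLimitSet hE hG hsub
  intro e he
  obtain ⟨φ, hφ, hgsh⟩ := h e he
  refine ⟨φ, ⟨Φ, hΦ, hφ⟩, fun c => ?_, fun γ hγ => (EReal.coe_pos.2 hν).trans_le (hgsh γ hγ)⟩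
  have : P.ε (φ c) ∈ P.ε '' Φ c := ⟨_, hφ c, rfl⟩
  rwa [hε c] at this

end ControlledPresentation

end CAT0Limit

end

open CAT0Limit
/-- The limit sets of `A` are computed from arbitrary controlled free presentations `P` (for the
dynamical one) and `Q` (for the horospherical one), so their independence of these choices is part
of the statement. -/
theorem theorem6p1 {G M A X X' : Type*} [Group G]
    [MetricSpace M] [ProperSpace M] [CAT0Space M] [MulAction G M] [IsIsometricSMul G M]
    [AddCommGroup A] [Module (MonoidAlgebra ℤ G) A] [Module.Finite (MonoidAlgebra ℤ G) A]
    [Finite X] [Finite X']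
    (P : ControlledPresentation G A M X) (Q : ControlledPresentation G A M X') :
    P.finitaryLimitSet =
        {e : Boundary M | closure (MulAction.orbit G e) ⊆ Q.horosphericalLimitSet} ∧
    (∀ E : Set (Boundary M), IsClosed E → (∀ (g : G), ∀ e ∈ E, g • e ∈ E) →
      (E ⊆ Q.horosphericalLimitSet ↔ E ⊆ P.finitaryLimitSet)) ∧
    (Q.horosphericalLimitSet = Set.univ ↔ P.finitaryLimitSet = Set.univ) ∧
    (∀ E : Set (Boundary M), IsClosed E → (∀ (g : G), ∀ e ∈ E, g • e ∈ E) →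
      E ⊆ Q.horosphericalLimitSet →
      ∃ (ν : ℝ) (Φ : FreeMod G X → Set (FreeMod G X)), 0 < ν ∧ IsVolley G Φ ∧
        (∀ c, P.ε '' Φ c = {P.ε c}) ∧
        ∀ e ∈ E, ∃ φ : FreeMod G X →+ FreeMod G X, IsSelection φ Φ ∧
          ∀ γ : GeodesicRay M, Boundary.mk γ = e → (ν : EReal) ≤ P.gsh γ φ) := by

  have hQP : Q.horosphericalLimitSet = P.horosphericalLimitSet := Q.horosphericalLimitSet_eq P
  have hinv : ∀ e : Boundary M, ∀ (g : G), ∀ e' ∈ closure (MulAction.orbit G e),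
      g • e' ∈ closure (MulAction.orbit G e) := fun e g e' he' =>
    map_mem_closure (continuous_const_smul g) he' (by
      rintro _ ⟨k, rfl⟩
      exact ⟨g * k, mul_smul g k e⟩)
  have key : P.finitaryLimitSet =
      {e : Boundary M | closure (MulAction.orbit G e) ⊆ P.horosphericalLimitSet} := by
    refine Set.Subset.antisymm (fun e => P.closure_orbit_subset_horosphericalLimitSet)
      fun e he => ?_
    exact P.subset_finitaryLimitSet isClosed_closure (hinv e) he
      (subset_closure (MulAction.mem_orbit_self e))
  have hE : ∀ E : Set (Boundary M), IsClosed E → (∀ (g : G), ∀ e ∈ E, g • e ∈ E) →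
      (E ⊆ P.horosphericalLimitSet ↔ E ⊆ P.finitaryLimitSet) := fun E hcl hG =>
    ⟨P.subset_finitaryLimitSet hcl hG, fun h e he =>
      P.closure_orbit_subset_horosphericalLimitSet (h he)
        (subset_closure (MulAction.mem_orbit_self e))⟩
  rw [hQP]
  refine ⟨key, hE, ?_, fun E => P.exists_volley_of_subset_horosphericalLimitSet⟩
  rw [← Set.univ_subset_iff, ← Set.univ_subset_iff]
  exact hE Set.univ isClosed_univ fun _ _ _ => Set.mem_univ _
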